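/- **Circuit model (Thompson).** The plane is divided into unit squares, two squares being adjacent when they share a side. A circuit has finitely many nodes, placed in distinct squares, and finitely many wires; a wire joins two nodes by a walk of positive length through adjacent squares and does not run through the square of a node in its interior. Each side of a square is passed at most once by at most one wire, and if a square that holds no node is passed twice, then both passes go straight on (a crossing). The area $A$ is the number of squares that are occupied by nodes or wires. The computation takes $T\ge 1$ clock cycles; in each cycle every wire carries one bit in each direction, the bits sent by a node are a function of its state, and its next state is a function of its state and of the bits it receives (no restriction is put on the state sets and on these functions). The circuit is fully parallel: each of the $n$ input symbols is injected before the first cycle into an input node of its own and determines, together with nothing else, the initial state of that node (the initial states of the other nodes are fixed), and each of the $k$ output bits is read after the last cycle from the state of an output node of its own. The energy is $E=AT$. **Decoding schemes.** Fix $0<\varepsilon<1$. An $(n,k)$-decoder is such a circuit, computing a function $\{0,1,?\}^n\to\{0,1\}^k$, together with an encoding function $\{0,1\}^k\to\{0,1\}^n$. Its block error probability $P_{\mathrm e}$ is the probability that its output differs from the message, when the message consists of $k$ independent fair bits and its encoding is sent through $n$ independent uses of the binary erasure channel with erasure probability $\varepsilon$ (erasure symbol $?$). A decoding scheme is a sequence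 of $(n,k(n))$-decoders whose block lengths $n$ are strictly increasing; $A(n)$, $T(n)$, $E(n)=A(n)T(n)$ and $P_{\mathrm e}(n)$ refer to its decoder of block length $n$. It has asymptotic rate $R$ if $k(n)/n\to R$. For $f:\mathbb N\to\mathbb R$ it is an $f(n)$-decoding scheme if $P_{\mathrm e}(n)<f(n)$ for all sufficiently large $n$. The function $f$ is sub-exponential if $f(n)>0$ for all sufficiently large $n$ and $-\ln f(n)/n\to 0$. Write $\ell(n)=-\ln f(n)$, with the convention $\sqrt{\ell(n)}=0$ where $\ell(n)<0$. For sequences $u,v$ indexed by the block lengths of the scheme, $u=\Omega(v)$ means that there is a constant $c>0$ with $u(n)\ge c\,v(n)$ for all sufficiently large $n$, and $u=\Theta(v)$ means that there are constants $b,c>0$ with $b\,v(n)\le u(n)\le c\,v(n)$ for all sufficiently large $n$. **Theorem.** Let $f$ be sub-exponential, and consider any $f(n)$-decoding scheme (with fully parallel circuits, for the binary erasure channel with erasure probability $\varepsilon$) that has an asymptotic rate $R>0$. 1. If $E(n)=\Theta\bigl(\sqrt{\ell(n)}\;n\bigr)$, then $T(n)=\Omega\bigl(\sqrt{\ell(n)}\bigr)$.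 2. Whatever its energy and its number of clock cycles, in particular if $T(n)$ grows more slowly than $\sqrt{\ell(n)}$, $$E(n)=\Omega\left(\frac{n\,\ell(n)}{T(n)}\right).$$ -/

import Mathlib

open Filter Topology

noncomputable section

namespace VLSI

/-! ## Bachmann–Landau notation for sequences of reals -/

/-- `u = Ω(v)`. -/
def IsOmega (u v : ℕ → ℝ) : Prop :=
  ∃ c : ℝ, 0 < c ∧ ∀ᶠ i in atTop, c * v i ≤ u i

/-- `u = Θ(v)`. -/
def IsTheta (u v : ℕ → ℝ) : Prop :=
  ∃ b c : ℝ, 0 < b ∧ 0 < c ∧ ∀ᶠ i in atTop, b * v i ≤ u i ∧ u i ≤ c * v i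

/-- `g` is sublinear: `g(n) / n → 0`. -/
def IsSublinear (g : ℕ → ℝ) : Prop :=
  Tendsto (fun n : ℕ => g n / (n : ℝ)) atTop (𝓝 0)

/-- `f` is sub-exponential: it is positive and `-ln f(n)` is sublinear, i.e. `f(n) = exp(-o(n))`. -/
def IsSubexponential (f : ℕ → ℝ) : Prop :=
  (∀ᶠ n in atTop, 0 < f n) ∧ IsSublinear (fun n => -Real.log (f n))

/-! ## Layouts on the planar grid of unit squares -/

/-- The unit squares of the plane, two of them being adjacent when they share a side. -/
def gridGraph : SimpleGraph (ℤ × ℤ) where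
  Adj p q := |p.1 - q.1| + |p.2 - q.2| = 1
  symm := ⟨fun p q h => by rwa [abs_sub_comm q.1, abs_sub_comm q.2]⟩
  loopless := ⟨fun p h => by simp at h⟩

/-- A Thompson-model layout: computational nodes and wires placed on the grid. Every square is
empty, or holds one node, or one wire, or the crossing of two wires; wires run from square to
square through the common side. -/
structure Layout where
  Node : Type
  Wire : Type
  [nodeFintype : Fintype Node]
  [wireFintype : Fintype Wire]
  /-- The two ends of a wire. -/
  src : Wire → Node
  tgt : Wire → Node
  /-- The square of a node. -/
  pos : Node → ℤ × ℤ
  pos_injective : Function.Injective pos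
  /-- The squares through which a wire runs, from the square of one end to that of the other. -/
  route : ∀ w, gridGraph.Walk (pos (src w)) (pos (tgt w))
  route_length_pos : ∀ w, 0 < (route w).length
  /-- No wire runs through the square of a node. -/
  route_avoids_nodes : ∀ w i, 0 < i → i < (route w).length → ∀ v, (route w).getVert i ≠ pos v
  /-- At most one wire passes through a side of a square, and at most once. -/
  route_isTrail : ∀ w, (route w).IsTrail
  route_disjoint : ∀ w w', w ≠ w' → List.Disjoint (route w).edges (route w').edges
  /-- Where a square is used twice, the wires go straight on (a crossing). -/
  route_crossing : ∀ w w' i j, i + 1 < (route w).length → j + 1 < (route w').length →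
    (route w).getVert (i + 1) = (route w').getVert (j + 1) → ¬ (w = w' ∧ i = j) →
    (route w).getVert i + (route w).getVert (i + 2) =
      (route w).getVert (i + 1) + (route w).getVert (i + 1)

attribute [instance] Layout.nodeFintype Layout.wireFintype

namespace Layout

variable (L : Layout)

/-- The occupied squares. -/
def occupied : Finset (ℤ × ℤ) :=
  Finset.univ.image L.pos ∪ Finset.univ.biUnion (fun w => (L.route w).support.toFinset)

/-- The area: the number of occupied squares (of side one). -/
def area : ℕ := L.occupied.card

/-- The node at the given end of a wire. -/
def endNode (p : L.Wire × Bool) : L.Node := if p.2 then L.tgt p.1 else L.src p.1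

/-- The wire ends attached to a node. -/
def Port (v : L.Node) : Type := {p : L.Wire × Bool // L.endNode p = v}

/-- The other end of a wire. -/
def opposite (p : L.Wire × Bool) : L.Wire × Bool := (p.1, !p.2)

end Layout

/-! ## Fully parallel circuits -/

/-- A fully parallel clocked circuit with `n` inputs from the alphabet `α` and `k` output bits.
Each input has a node of its own, into which it is injected before the first clock cycle; each
output bit has a node of its own, from which it is read after the last clock cycle. The nodes are
arbitrary synchronous machines: no bound is put on their memory or on the functions that they
compute. In every clock cycle every wire carries one bit in each direction. -/
structure Circuit (α : Type) (n k : ℕ) extends Layout where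
  input : Fin n → Node
  input_injective : Function.Injective input
  output : Fin k → Node
  output_injective : Function.Injective output
  State : Node → Type
  /-- The initial state of a node depends only on the input injected into it, if any. -/
  init : ∀ v, ({j : Fin n // input j = v} → α) → State v
  /-- The bits that a node sends, by its state, on the wires attached to it. -/
  send : ∀ v, State v → toLayout.Port v → Bool
  /-- The next state, from the current one and the bits received in the clock cycle. -/
  step : ∀ v, State v → (toLayout.Port v → Bool) → State v
  /-- The output bit, as a function of the final state of its node. -/
  read : ∀ j, State (output j) → Bool
  /-- The number `T` of clock cycles. -/
  cycles : ℕ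
  cycles_pos : 0 < cycles

namespace Circuit

variable {α : Type} {n k : ℕ} (C : Circuit α n k)

/-- The state of every node after `t` clock cycles, on the input word `x`. -/
def stateAt (x : Fin n → α) : ℕ → ∀ v, C.State v
  | 0 => fun v => C.init v (fun j => x j.1)
  | t + 1 => fun v => C.step v (stateAt x t v) (fun p =>
      C.send (C.endNode (C.opposite p.1)) (stateAt x t _) ⟨C.opposite p.1, rfl⟩)

/-- The function computed by the circuit. -/
def compute (x : Fin n → α) : Fin k → Bool :=
  fun j => C.read j (C.stateAt x C.cycles (C.output j))

/-- The energy `E = A T`. -/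
def energy : ℝ := (C.area : ℝ) * (C.cycles : ℝ)

end Circuit

/-! ## Decoders for the binary erasure channel -/

/-- Transition probabilities of the binary erasure channel with erasure probability `ε`;
`none` is the erasure symbol. -/
def becProb (ε : ℝ) (a : Bool) : Option Bool → ℝ
  | none => ε
  | some b => if b = a then 1 - ε else 0

/-- An `(n,k)`-decoder, together with the code (the encoding function) that it is meant for. -/
structure Decoder (n k : ℕ) where
  circuit : Circuit (Option Bool) n k
  encode : (Fin k → Bool) → (Fin n → Bool)

open scoped Classical in
/-- The block error probability: `k` independent fair bits are encoded and sent through `n`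
independent uses of the erasure channel, and the circuit's estimate is wrong. -/
def Decoder.blockErrorProb {n k : ℕ} (D : Decoder n k) (ε : ℝ) : ℝ :=
  ∑ u : Fin k → Bool, ∑ y : Fin n → Option Bool,
    (1 / 2 : ℝ) ^ k * (∏ i, becProb ε (D.encode u i) (y i)) *
      (if D.circuit.compute y = u then 0 else 1)

/-- A decoding scheme: a sequence of decoders with increasing block lengths. -/
structure DecodingScheme where
  blockLength : ℕ → ℕ
  blockLength_strictMono : StrictMono blockLength
  bits : ℕ → ℕ
  decoder : ∀ i, Decoder (blockLength i) (bits i)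

namespace DecodingScheme

variable (D : DecodingScheme)

/-- For all sufficiently large block lengths `n`, the block error probability is less than
`f n`. -/
def IsFDecoding (ε : ℝ) (f : ℕ → ℝ) : Prop :=
  ∀ᶠ i in atTop, (D.decoder i).blockErrorProb ε < f (D.blockLength i)

/-- The asymptotic rate of the scheme exists and equals `R`. -/
def HasRate (R : ℝ) : Prop :=
  Tendsto (fun i => (D.bits i : ℝ) / (D.blockLength i : ℝ)) atTop (𝓝 R)

/-- The energy of the `i`-th decoder. -/
def energy (i : ℕ) : ℝ := (D.decoder i).circuit.energy

/-- The number of clock cycles of the `i`-th decoder. -/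
def cycles (i : ℕ) : ℝ := ((D.decoder i).circuit.cycles : ℝ)

end DecodingScheme

end VLSI

end

/-!
Colour the nodes of the circuit so that each colour contains at most `a` inputs. With the inputs of
one colour class erased, its outputs depend only on the bits received from the other classes; if
these are fewer than the outputs, the class guesses, and the decoder fails with probability at least
`ε ^ a / 2`. For `a` of order `-ln P_e` this is excluded, so the wires between the classes carry at
least `k` bits in `T` cycles.

On the other hand, cut the plane into vertical strips of width `s` and walk through each strip row
by row, changing the colour after every `a` inputs. At most `A / s` sides of occupied squares lie on
the boundaries of well-placed strips, and each of the `n / a` changes of colour inside a strip is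
visible along at most `s + 1` sides. For `s` of order `√(A a / n)` this gives a colouring with
`O(√(A n / a))` wires between the classes. Together `k = O(T √(A n / a))`, that is,
`A T² = Ω(n a)` when `k` is proportional to `n`.
-/

namespace VLSI

open Finset

section Combinatorics

theorem card_filter_restrict_mem {ι β : Type*} [Fintype ι] [DecidableEq ι] [Fintype β]
    [DecidableEq β] (O : Finset ι) (V : Finset (O → β)) :
    #{u : ι → β | O.restrict u ∈ V} = #V * Fintype.card β ^ #Oᶜ := by
  calc #{u : ι → β | O.restrict u ∈ V}
      = #(V ×ˢ (univ : Finset ({i // i ∉ O} → β))) :=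
        card_equiv (Equiv.piEquivPiSubtypeProd (· ∈ O) fun _ => β) fun u => by
          simp only [mem_filter_univ, mem_product, mem_univ, and_true]
          rfl
    _ = #V * Fintype.card β ^ #Oᶜ := by
        simp [card_product, card_compl]

variable {ι β : Type*} [LinearOrder β]

theorem exists_monotone_card_fiber_le [Fintype ι] {m : ι → β} (hm : Function.Injective m)
    {a : ℕ} (ha : 0 < a) :
    ∃ h : β → ℕ, Monotone h ∧ (∀ q, h q ≤ Fintype.card ι / a) ∧ ∀ c, #{i | h (m i) = c} ≤ a := by
  let rank : β → ℕ := fun q => #{i | m i < q}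
  have rank_mono : Monotone rank := fun p q hpq =>
    card_le_card (monotone_filter_right _ fun i _ hi => hi.trans_le hpq)
  have rank_lt : ∀ {i j}, m i < m j → rank (m i) < rank (m j) := fun {i j} hij =>
    card_lt_card <| (ssubset_iff_of_subset
      (monotone_filter_right _ fun _ _ h => h.trans hij)).2 ⟨i, by simpa using hij, by simp⟩
  refine ⟨fun q => rank q / a, fun p q hpq => Nat.div_le_div_right (rank_mono hpq),
    fun q => Nat.div_le_div_right (card_le_univ _), fun c => ?_⟩
  have hcard : #{i | rank (m i) / a = c} ≤ #(Ico (c * a) (c * a + a)) := by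
    refine card_le_card_of_injOn (fun i => rank (m i)) (fun i hi => ?_) fun i _ j _ hij => ?_
    · have := (Nat.div_eq_iff ha).1 (mem_filter_univ i |>.1 hi)
      simp only [coe_Ico, Set.mem_Ico]
      lia
    · by_contra hne
      rcases lt_or_gt_of_ne (hm.ne hne) with h | h
      exacts [(rank_lt h).ne hij, (rank_lt h).ne' hij]
  simpa using hcard

theorem card_le_of_monotone_of_jumps {S : Finset ι} {x y : ι → β} (hx : Set.InjOn x S)
    (hxy : ∀ i ∈ S, x i ≤ y i) (hsep : ∀ i ∈ S, ∀ j ∈ S, x i < x j → y i ≤ x j)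
    {h : β → ℕ} (hmono : Monotone h) {N : ℕ} (hN : ∀ q, h q ≤ N)
    (hjump : ∀ i ∈ S, h (x i) ≠ h (y i)) : #S ≤ N := by
  have hlt : ∀ i ∈ S, h (x i) < h (y i) := fun i hi =>
    (hmono (hxy i hi)).lt_of_ne (hjump i hi)
  have hyy : ∀ i ∈ S, ∀ j ∈ S, x i < x j → h (y i) < h (y j) := fun i hi j hj hij =>
    (hmono (hsep i hi j hj hij)).trans_lt (hlt j hj)
  have hcard : #S ≤ #(Icc 1 N) := by
    refine card_le_card_of_injOn (fun i => h (y i)) (fun i hi => ?_) fun i hi j hj hij => ?_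
    · exact mem_coe.2 (mem_Icc.2 ⟨Nat.one_le_of_lt (hlt i hi), hN _⟩)
    · by_contra hne
      rcases lt_or_gt_of_ne (hx.ne hi hj hne) with hlt | hlt
      exacts [(hyy i hi j hj hlt).ne hij, (hyy j hj i hi hlt).ne' hij]
  simpa using hcard

end Combinatorics

section ErasureChannel

variable {ε : ℝ} {n k : ℕ}

theorem becProb_nonneg (hε0 : 0 ≤ ε) (hε1 : ε ≤ 1) (a : Bool) (b : Option Bool) :
    0 ≤ becProb ε a b := by
  cases b with
  | none => exact hε0
  | some b => simp only [becProb]; split_ifs <;> linarith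

theorem sum_becProb (a : Bool) : ∑ b, becProb ε a b = 1 := by
  cases a <;> simp [becProb, Fintype.sum_option]

theorem sum_prod_becProb_eq_pow (c : Fin n → Bool) (J : Finset (Fin n)) :
    ∑ y : Fin n → Option Bool with ∀ j ∈ J, y j = none, ∏ i, becProb ε (c i) (y i) =
      ε ^ #J := by
  have hpi : ({y | ∀ j ∈ J, y j = none} : Finset (Fin n → Option Bool)) =
      Fintype.piFinset fun i => if i ∈ J then {none} else univ := by
    ext y
    simp only [mem_filter_univ, Fintype.mem_piFinset]
    exact forall_congr' fun i => by split_ifs with hi <;> simp [hi]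
  have hfactor : ∀ i, ∑ b ∈ (if i ∈ J then {none} else univ), becProb ε (c i) b =
      if i ∈ J then ε else 1 := fun i => by
    split_ifs
    · simp [becProb]
    · exact sum_becProb _
  rw [hpi, ← prod_univ_sum, prod_congr rfl fun i _ => hfactor i]
  simp

namespace Decoder

variable (D : Decoder n k)

open scoped Classical in
theorem blockErrorProb_summand_nonneg (hε0 : 0 ≤ ε) (hε1 : ε ≤ 1) (u : Fin k → Bool)
    (y : Fin n → Option Bool) :
    0 ≤ (1 / 2 : ℝ) ^ k * (∏ i, becProb ε (D.encode u i) (y i)) *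
      (if D.circuit.compute y = u then 0 else 1) := by
  have hprod : 0 ≤ ∏ i, becProb ε (D.encode u i) (y i) :=
    prod_nonneg fun i _ => becProb_nonneg hε0 hε1 _ _
  split_ifs <;> positivity

theorem blockErrorProb_nonneg (hε0 : 0 ≤ ε) (hε1 : ε ≤ 1) : 0 ≤ D.blockErrorProb ε :=
  sum_nonneg fun u _ => sum_nonneg fun y _ => D.blockErrorProb_summand_nonneg hε0 hε1 u y

theorem pow_card_mul_le_blockErrorProb (hε0 : 0 ≤ ε) (hε1 : ε ≤ 1) (J : Finset (Fin n))
    (W : Finset (Fin k → Bool))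
    (hW : ∀ y : Fin n → Option Bool, (∀ j ∈ J, y j = none) → D.circuit.compute y ∈ W) :
    ε ^ #J * (#Wᶜ / 2 ^ k) ≤ D.blockErrorProb ε := by
  classical
  calc ε ^ #J * (#Wᶜ / 2 ^ k)
      = ∑ u ∈ Wᶜ, ∑ y : Fin n → Option Bool with ∀ j ∈ J, y j = none,
          (1 / 2 : ℝ) ^ k * ∏ i, becProb ε (D.encode u i) (y i) := by
        simp_rw [← mul_sum, sum_prod_becProb_eq_pow, sum_const, nsmul_eq_mul, one_div_pow]
        ring
    _ = ∑ u ∈ Wᶜ, ∑ y : Fin n → Option Bool with ∀ j ∈ J, y j = none,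
          (1 / 2 : ℝ) ^ k * (∏ i, becProb ε (D.encode u i) (y i)) *
            (if D.circuit.compute y = u then 0 else 1) := by
        refine sum_congr rfl fun u hu => sum_congr rfl fun y hy => ?_
        have hne : D.circuit.compute y ≠ u := by
          rintro rfl
          exact mem_compl.1 hu (hW y ((mem_filter_univ y).1 hy))
        rw [if_neg hne, mul_one]
    _ ≤ ∑ u ∈ Wᶜ, ∑ y, (1 / 2 : ℝ) ^ k * (∏ i, becProb ε (D.encode u i) (y i)) *
            (if D.circuit.compute y = u then 0 else 1) :=
        sum_le_sum fun u _ => sum_le_sum_of_subset_of_nonneg (subset_univ _)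
          fun y _ _ => D.blockErrorProb_summand_nonneg hε0 hε1 u y
    _ ≤ D.blockErrorProb ε :=
        sum_le_sum_of_subset_of_nonneg (subset_univ _)
          fun u _ _ => sum_nonneg fun y _ => D.blockErrorProb_summand_nonneg hε0 hε1 u y

theorem half_mul_pow_card_le_blockErrorProb (hε0 : 0 ≤ ε) (hε1 : ε ≤ 1) (J : Finset (Fin n))
    (O : Finset (Fin k)) (V : Finset (O → Bool)) (hV : 2 * #V ≤ 2 ^ #O)
    (hJ : ∀ y : Fin n → Option Bool, (∀ j ∈ J, y j = none) →
      O.restrict (D.circuit.compute y) ∈ V) :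
    1 / 2 * ε ^ #J ≤ D.blockErrorProb ε := by
  let W : Finset (Fin k → Bool) := {u | O.restrict u ∈ V}
  have hW : 2 * #W ≤ 2 ^ k :=
    calc 2 * #W = 2 * #V * 2 ^ #Oᶜ := by
          rw [card_filter_restrict_mem, Fintype.card_bool, mul_assoc]
      _ ≤ 2 ^ #O * 2 ^ #Oᶜ := by gcongr
      _ = 2 ^ k := by rw [← pow_add, card_add_card_compl, Fintype.card_fin]
  have hWc : 2 ^ k ≤ 2 * #Wᶜ := by
    have hadd : #W + #Wᶜ = 2 ^ k := by rw [card_add_card_compl]; simp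
    lia
  have hhalf : (1 / 2 : ℝ) ≤ #Wᶜ / 2 ^ k := by
    rw [div_le_div_iff₀ two_pos (by positivity), one_mul, mul_comm]
    exact_mod_cast hWc
  calc 1 / 2 * ε ^ #J ≤ ε ^ #J * (#Wᶜ / 2 ^ k) := by rw [mul_comm]; gcongr
    _ ≤ D.blockErrorProb ε := D.pow_card_mul_le_blockErrorProb hε0 hε1 J W fun y hy =>
        (mem_filter_univ _).2 (hJ y hy)

end Decoder

end ErasureChannel

section InformationFlow

open scoped Classical in
/-- The wire ends through which the set `S` of nodes receives bits from the other nodes. -/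
noncomputable def Layout.inPorts (L : Layout) (S : Set L.Node) : Finset (L.Wire × Bool) :=
  {p | L.endNode p ∈ S ∧ L.endNode (L.opposite p) ∉ S}

namespace Circuit

variable {α : Type} {n k : ℕ} (C : Circuit α n k) (S : Set C.Node)

open scoped Classical in
/-- The input symbols that are injected into the set `S` of nodes. -/
noncomputable def inputsIn : Finset (Fin n) := {j | C.input j ∈ S}

open scoped Classical in
/-- The output bits that are read from the set `S` of nodes. -/
noncomputable def outputsIn : Finset (Fin k) := {o | C.output o ∈ S}

/-- The bits that the set `S` of nodes receives from the other nodes during the computation on the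
input word `x`. -/
def incoming (x : Fin n → α) : Fin C.cycles × C.toLayout.inPorts S → Bool :=
  fun q => C.send (C.endNode (C.opposite q.2.1)) (C.stateAt x q.1 _) ⟨C.opposite q.2.1, rfl⟩

variable {S}

theorem stateAt_congr {x x' : Fin n → α} (hx : ∀ j ∈ C.inputsIn S, x j = x' j)
    (hin : C.incoming S x = C.incoming S x') {t : ℕ} (ht : t ≤ C.cycles) :
    ∀ v ∈ S, C.stateAt x t v = C.stateAt x' t v := by
  classical
  induction t with
  | zero =>
    intro v hv
    refine congrArg (C.init v) (funext fun ⟨j, hj⟩ => hx j ?_)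
    simpa [inputsIn, hj] using hv
  | succ t ih =>
    intro v hv
    have ih := ih (Nat.le_of_succ_le ht)
    refine congrArg₂ (C.step v) (ih v hv) (funext fun ⟨p, hp⟩ => ?_)
    by_cases hS : C.endNode (C.opposite p) ∈ S
    · simp only [ih _ hS]
    · have hmem : p ∈ C.toLayout.inPorts S := by
        simpa [Layout.inPorts, hp] using ⟨hv, hS⟩
      exact congrFun hin (⟨t, ht⟩, ⟨p, hmem⟩)

theorem restrict_compute_congr {x x' : Fin n → α} (hx : ∀ j ∈ C.inputsIn S, x j = x' j)
    (hin : C.incoming S x = C.incoming S x') :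
    (C.outputsIn S).restrict (C.compute x) = (C.outputsIn S).restrict (C.compute x') := by
  classical
  refine funext fun ⟨o, ho⟩ => congrArg (C.read o) ?_
  exact C.stateAt_congr hx hin le_rfl _ (by simpa [outputsIn] using ho)

variable (S)

theorem exists_card_le_two_pow_restrict_compute_mem (x₀ : Fin n → α) :
    ∃ V : Finset (C.outputsIn S → Bool), #V ≤ 2 ^ (C.cycles * #(C.toLayout.inPorts S)) ∧
      ∀ x, (∀ j ∈ C.inputsIn S, x j = x₀ j) →
        (C.outputsIn S).restrict (C.compute x) ∈ V := by
  classical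
  let X := {x : Fin n → α // ∀ j ∈ C.inputsIn S, x j = x₀ j}
  let out : X → C.outputsIn S → Bool := fun x => (C.outputsIn S).restrict (C.compute x.1)
  have hfactors : out.FactorsThrough fun x : X => C.incoming S x.1 := fun x x' h =>
    C.restrict_compute_congr (fun j hj => (x.2 j hj).trans (x'.2 j hj).symm) h
  let decode : (Fin C.cycles × C.toLayout.inPorts S → Bool) → C.outputsIn S → Bool :=
    Function.extend (fun x : X => C.incoming S x.1) out default
  refine ⟨univ.image decode, card_image_le.trans_eq (by simp), fun x hx => ?_⟩
  exact mem_image.2 ⟨C.incoming S x, mem_univ _, hfactors.extend_apply _ ⟨x, hx⟩⟩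

end Circuit

theorem Decoder.card_outputsIn_le {n k : ℕ} (D : Decoder n k) {ε : ℝ} (hε0 : 0 ≤ ε)
    (hε1 : ε ≤ 1) (S : Set D.circuit.Node)
    (herr : D.blockErrorProb ε < 1 / 2 * ε ^ #(D.circuit.inputsIn S)) :
    #(D.circuit.outputsIn S) ≤ D.circuit.cycles * #(D.circuit.toLayout.inPorts S) := by
  by_contra! hlt
  obtain ⟨V, hcard, hV⟩ :=
    D.circuit.exists_card_le_two_pow_restrict_compute_mem S fun _ => none
  refine herr.not_ge (D.half_mul_pow_card_le_blockErrorProb hε0 hε1 _ _ V ?_ hV)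
  calc 2 * #V ≤ 2 * 2 ^ (D.circuit.cycles * #(D.circuit.toLayout.inPorts S)) := by gcongr
    _ = 2 ^ (D.circuit.cycles * #(D.circuit.toLayout.inPorts S) + 1) := by ring
    _ ≤ 2 ^ #(D.circuit.outputsIn S) := Nat.pow_le_pow_right two_pos hlt

variable {κ : Type*} [DecidableEq κ]

/-- The wires whose ends are coloured differently by the colouring `g` of the nodes. -/
def Layout.cut (L : Layout) (g : L.Node → κ) : Finset L.Wire :=
  {w | g (L.src w) ≠ g (L.tgt w)}

theorem Layout.sum_card_inPorts (L : Layout) (g : L.Node → κ) :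
    ∑ c ∈ univ.image g, #(L.inPorts (g ⁻¹' {c})) = 2 * #(L.cut g) := by
  classical
  have hports : ({p | g (L.endNode p) ≠ g (L.endNode (L.opposite p))} : Finset (L.Wire × Bool)) =
      L.cut g ×ˢ univ := by
    ext ⟨w, b⟩
    cases b <;> simp [cut, endNode, opposite, ne_comm]
  have hfiber : ∀ c, L.inPorts (g ⁻¹' {c}) =
      {p ∈ L.cut g ×ˢ (univ : Finset Bool) | g (L.endNode p) = c} := by
    intro c
    ext p
    simp only [← hports, inPorts, mem_filter, Set.mem_preimage, Set.mem_singleton_iff]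
    grind
  calc ∑ c ∈ univ.image g, #(L.inPorts (g ⁻¹' {c})) = #(L.cut g ×ˢ (univ : Finset Bool)) := by
        simp_rw [hfiber]
        exact (card_eq_sum_card_fiberwise fun p _ =>
          mem_coe.2 (mem_image_of_mem g (mem_univ (L.endNode p)))).symm
    _ = 2 * #(L.cut g) := by rw [card_product, card_univ, Fintype.card_bool, mul_comm]

theorem Decoder.bits_le_two_mul_cycles_mul_card_cut {n k : ℕ} (D : Decoder n k) {ε : ℝ}
    (hε0 : 0 ≤ ε) (hε1 : ε ≤ 1) {a : ℕ} (herr : D.blockErrorProb ε < 1 / 2 * ε ^ a)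
    (g : D.circuit.Node → κ) (hg : ∀ c, #{j | g (D.circuit.input j) = c} ≤ a) :
    k ≤ 2 * D.circuit.cycles * #(D.circuit.toLayout.cut g) := by
  have hclass : ∀ c, #{o | g (D.circuit.output o) = c} ≤
      D.circuit.cycles * #(D.circuit.toLayout.inPorts (g ⁻¹' {c})) := by
    intro c
    have hinputs : #(D.circuit.inputsIn (g ⁻¹' {c})) ≤ a := by
      simpa [Circuit.inputsIn] using hg c
    have hle := D.card_outputsIn_le hε0 hε1 (g ⁻¹' {c}) <| herr.trans_le <|
      mul_le_mul_of_nonneg_left (pow_le_pow_of_le_one hε0 hε1 hinputs) one_half_pos.le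
    simpa [Circuit.outputsIn] using hle
  calc k = #(univ : Finset (Fin k)) := (card_fin k).symm
    _ = ∑ c ∈ univ.image g, #{o | g (D.circuit.output o) = c} :=
        card_eq_sum_card_fiberwise fun o _ => mem_coe.2 (mem_image_of_mem g (mem_univ _))
    _ ≤ ∑ c ∈ univ.image g, D.circuit.cycles * #(D.circuit.toLayout.inPorts (g ⁻¹' {c})) :=
        sum_le_sum fun c _ => hclass c
    _ = 2 * D.circuit.cycles * #(D.circuit.toLayout.cut g) := by
        rw [← mul_sum, Layout.sum_card_inPorts, mul_left_comm, mul_assoc]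

end InformationFlow

section Strips

theorem gridGraph_adj_iff {p q : ℤ × ℤ} :
    gridGraph.Adj p q ↔ (q = p + (0, 1) ∨ p = q + (0, 1)) ∨ (q = p + (1, 0) ∨ p = q + (1, 0)) := by
  obtain ⟨x, y⟩ := p
  obtain ⟨x', y'⟩ := q
  change |x - x'| + |y - y'| = 1 ↔ _
  simp only [Prod.mk_add_mk, Prod.mk.injEq]
  grind

/-- The key by which the squares are ordered lexicographically: first by the strip `σ x` that
contains the column `x`, then by rows, then by columns. -/
def stripKey (σ : ℤ → ℤ) (p : ℤ × ℤ) : ℤ ×ₗ ℤ ×ₗ ℤ :=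
  toLex (σ p.1, toLex (p.2, p.1))

variable {σ : ℤ → ℤ}

theorem stripKey_injective : Function.Injective (stripKey σ) := by
  rintro ⟨x, y⟩ ⟨x', y'⟩ h
  simp_all [stripKey]

theorem stripKey_le_iff {p q : ℤ × ℤ} : stripKey σ p ≤ stripKey σ q ↔
    σ p.1 < σ q.1 ∨ σ p.1 = σ q.1 ∧ (p.2 < q.2 ∨ p.2 = q.2 ∧ p.1 ≤ q.1) := by
  simp [stripKey, Prod.Lex.toLex_le_toLex]

theorem stripKey_lt_iff {p q : ℤ × ℤ} : stripKey σ p < stripKey σ q ↔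
    σ p.1 < σ q.1 ∨ σ p.1 = σ q.1 ∧ (p.2 < q.2 ∨ p.2 = q.2 ∧ p.1 < q.1) := by
  simp [stripKey, Prod.Lex.toLex_lt_toLex]

variable {h : ℤ ×ₗ ℤ ×ₗ ℤ → ℕ} {N : ℕ} {S : Finset (ℤ × ℤ)}

theorem card_vertical_jumps_le (hmono : Monotone h) (hN : ∀ q, h q ≤ N)
    (hS : ∀ p ∈ S, ∀ q ∈ S, σ p.1 = σ q.1 → p.1 = q.1)
    (hjump : ∀ p ∈ S, h (stripKey σ p) ≠ h (stripKey σ (p + (0, 1)))) : #S ≤ N := by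
  refine card_le_of_monotone_of_jumps stripKey_injective.injOn (fun p _ => ?_)
    (fun p hp q hq hpq => ?_) hmono hN hjump
  · simp [stripKey_le_iff]
  · have hcol := hS p hp q hq
    simp only [stripKey_lt_iff, stripKey_le_iff, Prod.fst_add, Prod.snd_add] at hpq ⊢
    grind

theorem card_horizontal_jumps_le (hmono : Monotone h) (hN : ∀ q, h q ≤ N)
    (hS : ∀ p ∈ S, σ (p.1 + 1) = σ p.1)
    (hjump : ∀ p ∈ S, h (stripKey σ p) ≠ h (stripKey σ (p + (1, 0)))) : #S ≤ N := by
  refine card_le_of_monotone_of_jumps stripKey_injective.injOn (fun p hp => ?_)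
    (fun p hp q _ hpq => ?_) hmono hN hjump
  · simp [stripKey_le_iff, hS p hp]
  · have hstrip := hS p hp
    simp only [stripKey_lt_iff, stripKey_le_iff, Prod.fst_add, Prod.snd_add] at hpq ⊢
    grind

/-- The number of the strip that contains the column `x`, for strips of width `s` of which one
starts at the column `r`. -/
def strip (s : ℕ) (r x : ℤ) : ℤ := (x - r) / s

variable {s : ℕ} {r : ℤ}

theorem eq_of_strip_eq_of_modEq {x x' : ℤ} (hmod : x ≡ x' [ZMOD s])
    (hstrip : strip s r x = strip s r x') : x = x' := by
  have hmod' : (x - r) % s = (x' - r) % s := hmod.sub_right r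
  have hx := Int.emod_add_mul_ediv (x - r) s
  have hx' := Int.emod_add_mul_ediv (x' - r) s
  rw [hmod', show (x - r) / s = (x' - r) / s from hstrip] at hx
  linarith

theorem strip_add_one_of_not_dvd (hs : 0 < s) {x : ℤ} (hx : ¬ (s : ℤ) ∣ x + 1 - r) :
    strip s r (x + 1) = strip s r x := by
  have hs' : (0 : ℤ) < s := by exact_mod_cast hs
  have hdiv := Int.emod_add_mul_ediv (x - r) s
  have hnonneg := Int.emod_nonneg (x - r) hs'.ne'
  have hlt := Int.emod_lt_of_pos (x - r) hs'
  have hne : (x - r) % s + 1 ≠ s := fun h => hx ⟨(x - r) / s + 1, by linarith⟩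
  exact ((Int.ediv_emod_unique hs' (r := (x - r) % s + 1)).2
    ⟨by rw [strip]; linarith, by lia, by lia⟩).1

theorem exists_card_filter_dvd_le (hs : 0 < s) (S : Finset (ℤ × ℤ)) :
    ∃ r : ℤ, (#{p ∈ S | (s : ℤ) ∣ p.1 + 1 - r} : ℝ) ≤ #S / s := by
  obtain ⟨r, hr, hcard⟩ := exists_card_fiber_le_of_card_le_nsmul
    (s := S) (t := Ico (0 : ℤ) s) (f := fun p => (p.1 + 1) % (s : ℤ)) (b := (#S : ℝ) / s)
    ⟨0, by simpa using hs⟩ (by simp [mul_div_cancel₀, hs.ne'])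
  refine ⟨r, le_of_eq_of_le ?_ hcard⟩
  congr! 3 with p
  rw [← Int.modEq_iff_dvd, Int.modEq_comm, Int.ModEq,
    Int.emod_eq_of_lt (mem_Ico.1 hr).1 (mem_Ico.1 hr).2]

end Strips

namespace Layout

variable (L : Layout)

theorem card_le_area {ι : Type*} [Fintype ι] {m : ι → L.Node} (hm : Function.Injective m) :
    Fintype.card ι ≤ L.area := by
  classical
  calc Fintype.card ι = #(univ.image (L.pos ∘ m)) :=
        (card_image_of_injective _ (L.pos_injective.comp hm)).symm
    _ ≤ L.area := card_le_card fun p hp => by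
        obtain ⟨i, -, rfl⟩ := mem_image.1 hp
        exact mem_union_left _ (mem_image_of_mem _ (mem_univ _))

theorem mem_occupied_of_mem_support {w : L.Wire} {p : ℤ × ℤ} (hp : p ∈ (L.route w).support) :
    p ∈ L.occupied :=
  mem_union_right _ (mem_biUnion.2 ⟨w, mem_univ _, List.mem_toFinset.2 hp⟩)

theorem card_cut_comp_pos_le {κ : Type*} [DecidableEq κ] (h : ℤ × ℤ → κ) :
    #(L.cut (h ∘ L.pos)) ≤
      #{p ∈ L.occupied | h p ≠ h (p + (0, 1))} + #{p ∈ L.occupied | h p ≠ h (p + (1, 0))} := by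
  set V := {p ∈ L.occupied | h p ≠ h (p + (0, 1))}
  set H := {p ∈ L.occupied | h p ≠ h (p + (1, 0))}
  let sides : Finset (Sym2 (ℤ × ℤ)) :=
    V.image (fun p => s(p, p + (0, 1))) ∪ H.image (fun p => s(p, p + (1, 0)))
  have hcross : ∀ w ∈ L.cut (h ∘ L.pos), ∃ e ∈ (L.route w).edges, e ∈ sides := by
    intro w hw
    obtain ⟨d, hd, hfst, hsnd⟩ := (L.route w).exists_boundary_dart
      {p | h p = h (L.pos (L.src w))} rfl fun heq => (mem_filter_univ w).1 hw heq.symm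
    have hne : h d.fst ≠ h d.snd := fun heq => hsnd (heq.symm.trans hfst)
    have hedge : s(d.fst, d.snd) ∈ (L.route w).edges := List.mem_map_of_mem hd
    have hfst_occ :=
      L.mem_occupied_of_mem_support ((L.route w).fst_mem_support_of_mem_edges hedge)
    have hsnd_occ :=
      L.mem_occupied_of_mem_support ((L.route w).snd_mem_support_of_mem_edges hedge)
    refine ⟨_, hedge, ?_⟩
    simp only [sides, V, H, mem_union, mem_image, mem_filter]
    rcases gridGraph_adj_iff.1 d.adj with (heq | heq) | (heq | heq)
    · exact .inl ⟨d.fst, ⟨hfst_occ, heq ▸ hne⟩, by rw [heq]⟩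
    · exact .inl ⟨d.snd, ⟨hsnd_occ, heq ▸ hne.symm⟩, by rw [heq, Sym2.eq_swap]⟩
    · exact .inr ⟨d.fst, ⟨hfst_occ, heq ▸ hne⟩, by rw [heq]⟩
    · exact .inr ⟨d.snd, ⟨hsnd_occ, heq ▸ hne.symm⟩, by rw [heq, Sym2.eq_swap]⟩
  choose! side hside hmem using hcross
  calc #(L.cut (h ∘ L.pos)) ≤ #sides :=
        card_le_card_of_injOn side hmem fun w hw w' hw' heq => by
          by_contra hne
          exact L.route_disjoint w w' hne (hside w hw) (heq ▸ hside w' hw')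
    _ ≤ #V + #H := (card_union_le _ _).trans (add_le_add card_image_le card_image_le)

theorem exists_coloring_card_cut_le {ι : Type*} [Fintype ι] {m : ι → L.Node}
    (hm : Function.Injective m) {s a : ℕ} (hs : 0 < s) (ha : 0 < a) :
    ∃ g : L.Node → ℕ, (∀ c, #{i | g (m i) = c} ≤ a) ∧
      (#(L.cut g) : ℝ) ≤ L.area / s + Fintype.card ι / a * (s + 1) := by
  obtain ⟨r, hr⟩ := exists_card_filter_dvd_le hs L.occupied
  let key := stripKey (strip s r)
  obtain ⟨h, hmono, hN, hfiber⟩ := exists_monotone_card_fiber_le (m := fun i => key (L.pos (m i)))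
    (stripKey_injective.comp (L.pos_injective.comp hm)) ha
  refine ⟨(h ∘ key) ∘ L.pos, hfiber, ?_⟩
  set N := Fintype.card ι / a
  set V := {p ∈ L.occupied | (h ∘ key) p ≠ (h ∘ key) (p + (0, 1))}
  set H := {p ∈ L.occupied | (h ∘ key) p ≠ (h ∘ key) (p + (1, 0))}
  have hV : #V ≤ N * s := by
    have hs' : (s : ℤ) ≠ 0 := by exact_mod_cast hs.ne'
    have hmaps : ∀ p ∈ V, p.1 % (s : ℤ) ∈ Ico (0 : ℤ) s := fun p _ =>
      mem_Ico.2 ⟨Int.emod_nonneg _ hs', Int.emod_lt_of_pos _ (by exact_mod_cast hs)⟩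
    have hcol : ∀ c ∈ Ico (0 : ℤ) s, #{p ∈ V | p.1 % (s : ℤ) = c} ≤ N := fun c _ =>
      card_vertical_jumps_le hmono hN
        (fun p hp q hq => eq_of_strip_eq_of_modEq
          ((mem_filter.1 hp).2.trans (mem_filter.1 hq).2.symm))
        fun p hp => (mem_filter.1 (mem_filter.1 hp).1).2
    simpa using card_le_mul_card_image_of_maps_to hmaps N hcol
  have hH : #H ≤ #{p ∈ L.occupied | (s : ℤ) ∣ p.1 + 1 - r} + N := by
    rw [← card_filter_add_card_filter_not (s := H) fun p => (s : ℤ) ∣ p.1 + 1 - r]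
    refine add_le_add (card_le_card (filter_subset_filter _ (filter_subset _ _))) ?_
    exact card_horizontal_jumps_le hmono hN
      (fun p hp => strip_add_one_of_not_dvd hs (mem_filter.1 hp).2)
      fun p hp => (mem_filter.1 (mem_filter.1 hp).1).2
  calc (#(L.cut ((h ∘ key) ∘ L.pos)) : ℝ)
      ≤ N * s + (#{p ∈ L.occupied | (s : ℤ) ∣ p.1 + 1 - r} + N) := by
        exact_mod_cast (L.card_cut_comp_pos_le (h ∘ key)).trans (add_le_add hV hH)
    _ ≤ L.area / s + N * (s + 1) := by rw [area]; linarith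
    _ ≤ L.area / s + Fintype.card ι / a * (s + 1) := by gcongr; exact Nat.cast_div_le

end Layout

section EnergyBound

theorem exists_nat_div_add_mul_le_four_mul_sqrt {A B : ℝ} (hB : 0 < B) (hBA : B ≤ A) :
    ∃ s : ℕ, 0 < s ∧ A / s + B * (s + 1) ≤ 4 * √(A * B) := by
  have hA : 0 < A := hB.trans_le hBA
  set x := √(A / B)
  have hx : 1 ≤ x := Real.one_le_sqrt.2 ((one_le_div hB).2 hBA)
  have hBx : B * x = √(A * B) := by
    refine ((Real.sqrt_eq_iff_mul_self_eq (by positivity) (by positivity)).2 ?_).symm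
    rw [mul_mul_mul_comm, Real.mul_self_sqrt (by positivity)]
    field_simp
  have hAx : A / x = √(A * B) := by
    rw [← hBx, div_eq_iff (by positivity), mul_assoc, Real.mul_self_sqrt (by positivity)]
    field_simp
  have hs : 0 < ⌊x⌋₊ := Nat.floor_pos.2 hx
  have hs1 : (1 : ℝ) ≤ ⌊x⌋₊ := by exact_mod_cast hs
  have hx2 : x / 2 ≤ ⌊x⌋₊ := by linarith [Nat.lt_floor_add_one x]
  refine ⟨⌊x⌋₊, hs, ?_⟩
  calc A / ⌊x⌋₊ + B * (⌊x⌋₊ + 1) ≤ A / (x / 2) + B * (x + x) := by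
        gcongr
        exact Nat.floor_le (by positivity)
    _ = 2 * (A / x) + 2 * (B * x) := by ring
    _ = 4 * √(A * B) := by rw [hAx, hBx]; ring

theorem Layout.exists_coloring_card_cut_le_sqrt (L : Layout) {ι : Type*} [Fintype ι] [Nonempty ι]
    {m : ι → L.Node} (hm : Function.Injective m) {a : ℕ} (ha : 0 < a) :
    ∃ g : L.Node → ℕ, (∀ c, #{i | g (m i) = c} ≤ a) ∧
      (#(L.cut g) : ℝ) ≤ 4 * √(L.area * (Fintype.card ι / a)) := by
  have hle : (Fintype.card ι / a : ℝ) ≤ L.area :=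
    (div_le_self (by positivity) (by exact_mod_cast ha)).trans
      (by exact_mod_cast L.card_le_area hm)
  obtain ⟨s, hs, hbalance⟩ := exists_nat_div_add_mul_le_four_mul_sqrt (by positivity) hle
  obtain ⟨g, hg, hcut⟩ := L.exists_coloring_card_cut_le hm hs ha
  exact ⟨g, hg, hcut.trans hbalance⟩

theorem exists_nat_pow_of_log_two_div_lt {ε l : ℝ} (hε0 : 0 < ε) (hε1 : ε ≤ 1)
    (hl : Real.log (2 / ε) < l) :
    ∃ a : ℕ, 0 < a ∧ l ≤ 2 * Real.log (2 / ε) * a ∧ Real.exp (-l) ≤ 1 / 2 * ε ^ a := by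
  have hlog : 0 < Real.log (2 / ε) :=
    Real.log_pos ((one_lt_div hε0).2 (hε1.trans_lt one_lt_two))
  set a := ⌊l / Real.log (2 / ε)⌋₊
  have ha : 0 < a := Nat.floor_pos.2 ((one_le_div hlog).2 hl.le)
  have ha1 : (1 : ℝ) ≤ a := by exact_mod_cast ha
  have hal : a * Real.log (2 / ε) ≤ l :=
    (le_div_iff₀ hlog).1 (Nat.floor_le (by have := hlog.trans hl; positivity))
  refine ⟨a, ha, ?_, ?_⟩
  · have hlt : l < (a + 1) * Real.log (2 / ε) := (div_lt_iff₀ hlog).1 (Nat.lt_floor_add_one _)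
    nlinarith
  · calc Real.exp (-l) ≤ Real.exp (-(a * Real.log (2 / ε))) := by gcongr
      _ = (1 / 2) ^ a * ε ^ a := by
        rw [Real.exp_neg, Real.exp_nat_mul, Real.exp_log (by positivity), ← inv_pow, inv_div,
          ← mul_pow, one_div_mul_eq_div]
      _ ≤ 1 / 2 * ε ^ a := by
        gcongr
        exact pow_le_of_le_one (by norm_num) (by norm_num) ha.ne'

variable {ε : ℝ} {n k : ℕ}

theorem Decoder.sq_bits_mul_le (D : Decoder n k) (hε0 : 0 ≤ ε) (hε1 : ε ≤ 1) (hn : 0 < n) {a : ℕ}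
    (ha : 0 < a) (herr : D.blockErrorProb ε < 1 / 2 * ε ^ a) :
    (k : ℝ) ^ 2 * a ≤ 64 * (D.circuit.energy * D.circuit.cycles) * n := by
  have : Nonempty (Fin n) := Fin.pos_iff_nonempty.1 hn
  obtain ⟨g, hg, hcut⟩ :=
    D.circuit.toLayout.exists_coloring_card_cut_le_sqrt D.circuit.input_injective ha
  rw [Fintype.card_fin] at hcut
  have hk : (k : ℝ) ≤ 2 * D.circuit.cycles * #(D.circuit.toLayout.cut g) := by
    exact_mod_cast D.bits_le_two_mul_cycles_mul_card_cut hε0 hε1 herr g hg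
  set A : ℝ := (D.circuit.area : ℝ)
  set T : ℝ := (D.circuit.cycles : ℝ)
  calc (k : ℝ) ^ 2 * a ≤ (2 * T * (4 * √(A * (n / a)))) ^ 2 * a := by
        gcongr
        exact hk.trans (by gcongr)
    _ = 64 * T ^ 2 * √(A * (n / a)) ^ 2 * a := by ring
    _ = 64 * (A * T * T) * n := by rw [Real.sq_sqrt (by positivity)]; field_simp

theorem Decoder.mul_neg_log_le_energy_mul_cycles (D : Decoder n k) (hε0 : 0 < ε) (hε1 : ε ≤ 1)
    (hn : 0 < n) {ρ : ℝ} (hρ : 0 ≤ ρ) (hk : ρ * n ≤ k) {δ : ℝ} (herr : D.blockErrorProb ε < δ) :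
    min 1 (ρ ^ 2 / 128) / Real.log (2 / ε) * (n * -Real.log δ) ≤
      D.circuit.energy * D.circuit.cycles := by
  set lam := Real.log (2 / ε)
  set l := -Real.log δ with hl
  have hlam : 0 < lam := Real.log_pos ((one_lt_div hε0).2 (hε1.trans_lt one_lt_two))
  have hnA : (n : ℝ) ≤ D.circuit.area := by
    simpa using D.circuit.toLayout.card_le_area D.circuit.input_injective
  have hT : (1 : ℝ) ≤ D.circuit.cycles := by exact_mod_cast D.circuit.cycles_pos
  rcases le_or_gt l lam with hle | hlt
  · calc min 1 (ρ ^ 2 / 128) / lam * (n * l) ≤ min 1 (ρ ^ 2 / 128) / lam * (n * lam) := by gcongr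
      _ ≤ 1 / lam * (n * lam) := by gcongr; exact min_le_left _ _
      _ = n * 1 * 1 := by field_simp
      _ ≤ D.circuit.energy * D.circuit.cycles := by rw [Circuit.energy]; gcongr
  · obtain ⟨a, ha, hla, hexp⟩ := exists_nat_pow_of_log_two_div_lt hε0 hε1 hlt
    have hδ : Real.exp (-l) = δ := by
      rw [hl, neg_neg, Real.exp_log ((D.blockErrorProb_nonneg hε0.le hε1).trans_lt herr)]
    have hsq := D.sq_bits_mul_le hε0.le hε1 hn ha (herr.trans_le (hδ ▸ hexp))
    have hl0 : 0 < l := hlam.trans hlt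
    refine le_of_mul_le_mul_right ?_ (show (0 : ℝ) < 64 * n by positivity)
    calc min 1 (ρ ^ 2 / 128) / lam * (n * l) * (64 * n)
        ≤ ρ ^ 2 / 128 / lam * (n * (2 * lam * a)) * (64 * n) := by
          gcongr
          exact min_le_right _ _
      _ = (ρ * n) ^ 2 * a := by field_simp; ring
      _ ≤ k ^ 2 * a := by gcongr
      _ ≤ D.circuit.energy * D.circuit.cycles * (64 * n) := by linarith

end EnergyBound

section Asymptotics

theorem IsTheta.isOmega_swap {u v : ℕ → ℝ} : IsTheta u v → IsOmega v u := by
  rintro ⟨_, c, _, hc, hbound⟩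
  refine ⟨c⁻¹, inv_pos.2 hc, hbound.mono fun i hi => ?_⟩
  rw [inv_mul_le_iff₀ hc]
  exact hi.2

theorem DecodingScheme.HasRate.eventually_mul_le {D : DecodingScheme} {R ρ : ℝ}
    (hrate : D.HasRate R) (hρ : ρ < R) :
    ∀ᶠ i in atTop, ρ * D.blockLength i ≤ D.bits i := by
  filter_upwards [hrate.eventually_const_lt hρ,
    D.blockLength_strictMono.tendsto_atTop.eventually_gt_atTop 0] with i hi hn
  exact ((lt_div_iff₀ (by exact_mod_cast hn)).1 hi).le

theorem mul_sqrt_le_of_mul_le {b c n l E T : ℝ} (hb : 0 ≤ b) (hn : 0 < n) (hT : 0 ≤ T)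
    (hlower : c * (n * l) ≤ E * T) (hupper : b * E ≤ √l * n) : b * c * √l ≤ T := by
  rcases le_or_gt l 0 with hl | hl
  · simpa [Real.sqrt_eq_zero'.2 hl] using hT
  · refine le_of_mul_le_mul_right ?_ (mul_pos (Real.sqrt_pos.2 hl) hn)
    calc b * c * √l * (√l * n) = b * (c * (n * (√l * √l))) := by ring
      _ = b * (c * (n * l)) := by rw [Real.mul_self_sqrt hl.le]
      _ ≤ b * (E * T) := by gcongr
      _ = b * E * T := by ring
      _ ≤ √l * n * T := by gcongr
      _ = T * (√l * n) := by ring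

end Asymptotics

end VLSI

open VLSI in
theorem mainTheorem3_general {ε : ℝ} (hε0 : 0 < ε) (hε1 : ε ≤ 1) {f : ℕ → ℝ} {D : DecodingScheme}
    (hD : D.IsFDecoding ε f) {ρ : ℝ} (hρ : 0 < ρ)
    (hrate : ∀ᶠ i in atTop, ρ * D.blockLength i ≤ D.bits i) :
    (IsOmega (fun i => √(-Real.log (f (D.blockLength i))) * D.blockLength i) D.energy →
      IsOmega D.cycles (fun i => √(-Real.log (f (D.blockLength i))))) ∧
    IsOmega D.energy (fun i => D.blockLength i * -Real.log (f (D.blockLength i)) / D.cycles i) := by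
  set c := min 1 (ρ ^ 2 / 128) / Real.log (2 / ε)
  have hc : 0 < c := div_pos (by positivity)
    (Real.log_pos ((one_lt_div hε0).2 (hε1.trans_lt one_lt_two)))
  have hn : ∀ᶠ i in atTop, 0 < D.blockLength i :=
    D.blockLength_strictMono.tendsto_atTop.eventually_gt_atTop 0
  have hT : ∀ i, 0 < D.cycles i := fun i => Nat.cast_pos.2 (D.decoder i).circuit.cycles_pos
  have hbound : ∀ᶠ i in atTop,
      c * (D.blockLength i * -Real.log (f (D.blockLength i))) ≤ D.energy i * D.cycles i := by
    filter_upwards [hn, hrate, hD] with i hn hk herr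
    exact (D.decoder i).mul_neg_log_le_energy_mul_cycles hε0 hε1 hn hρ.le hk herr
  refine ⟨fun ⟨b, hb, hE⟩ => ⟨b * c, mul_pos hb hc, ?_⟩, c, hc, ?_⟩
  · filter_upwards [hbound, hE, hn] with i hlower hupper hn
    exact mul_sqrt_le_of_mul_le hb.le (Nat.cast_pos.2 hn) (hT i).le hlower hupper
  · filter_upwards [hbound] with i hlower
    rwa [← mul_div_assoc, div_le_iff₀ (hT i)]

theorem mainTheorem3 (ε : ℝ) (hε0 : 0 < ε) (hε1 : ε < 1)
    (f : ℕ → ℝ) (hf : VLSI.IsSubexponential f)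
    (D : VLSI.DecodingScheme) (hD : D.IsFDecoding ε f)
    (R : ℝ) (hR : 0 < R) (hrate : D.HasRate R) :
    (VLSI.IsTheta D.energy
        (fun i => √(-Real.log (f (D.blockLength i))) * (D.blockLength i : ℝ)) →
      VLSI.IsOmega D.cycles (fun i => √(-Real.log (f (D.blockLength i))))) ∧
    VLSI.IsOmega D.energy
      (fun i => (D.blockLength i : ℝ) * (-Real.log (f (D.blockLength i))) / D.cycles i) := by
  have h := mainTheorem3_general hε0 hε1.le hD (half_pos hR)
    (hrate.eventually_mul_le (half_lt_self hR))
  exact ⟨fun hE => h.1 hE.isOmega_swap, h.2⟩
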